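/- Let $L\ge 1$ and let $G$ be a Lie subgroup of $\mathrm{Gl}(L,\mathbb R)$ with inclusion $\iota:G\to\mathrm{Gl}(L,\mathbb R)$. Its Maurer–Cartan form is the matrix-valued $1$-form $\Gamma_G:=\iota^*\gamma$ on $G$, where $\gamma_z:=z^{-1}\,dz$, that is, $\gamma^{(ij)}_z=\sum_q (z^{-1})_{iq}\,dz_{qj}$ for $z=(z_{ij})\in\mathrm{Gl}(L,\mathbb R)$. Let $\mathcal M$ be an $M$-dimensional $C^2$ manifold and let $\phi=(\phi^{(ij)})$ be an $L\times L$ matrix of $C^1$ differential $1$-forms on $\mathcal M$. Pullback and $d$ act entrywise on such matrices, and $(\phi\wedge\phi)^{(ij)}:=\sum_q\phi^{(iq)}\wedge\phi^{(qj)}$. For an open set $\mathcal U\subset\mathcal M$ and a $C^1$ map $f:\mathcal U\to G$, write $\{f^*\Gamma_G=\phi|_{\mathcal U}\}:=\{Q\in\mathcal U : (f^*\Gamma_G)_Q=\phi_Q\}$. A point $Q\in\mathcal M$ is an $m$-density point of a set $\mathcal E\subset\mathcal M$ if there is a $C^1$ chart $(\mathcal W,\Phi)$ of $\mathcal M$ with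 $Q\in\mathcal W$ and $$\mathcal L^M\big(B_r(\Phi(Q))\setminus\Phi(\mathcal E\cap\mathcal W)\big)=o(r^m)\quad\text{as } r\to0+,$$ where $\mathcal L^M$ is Lebesgue (outer) measure on $\mathbb R^M$; $\mathcal E^{(m)}$ denotes the set of all such points. (i) If $P\in\mathcal M$ satisfies $(d\phi)_P\ne-(\phi\wedge\phi)_P$, then there is an open neighborhood $\mathcal U$ of $P$ such that $$\mathcal U\cap\{f^*\Gamma_G=\phi|_{\mathcal U}\}^{(M+1)}=\emptyset\quad\text{for every } C^1 \text{ map } f:\mathcal U\to G.$$ (ii) In particular, if $(d\phi)_Q\ne-(\phi\wedge\phi)_Q$ for all $Q\in\mathcal M$, then $\mathcal U\cap\{f^*\Gamma_G=\phi|_{\mathcal U}\}^{(M+1)}=\emptyset$ for every open $\mathcal U\subset\mathcal M$ and every $C^1$ map $f:\mathcal U\to G$. -/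

import Mathlib

open Set Filter Topology MeasureTheory
open scoped Manifold ContDiff Asymptotics

noncomputable section

namespace MCForms

/-! ### Differential forms -/

section Forms

variable {E : Type*} [NormedAddCommGroup E] [NormedSpace ℝ E]
  {H : Type*} [TopologicalSpace H] (I : ModelWithCorners ℝ E H)
  (M : Type*) [TopologicalSpace M] [ChartedSpace H M]

/-- Real valued differential `h`-forms on `M`, without any regularity: an alternating `h`-linear
form on the tangent space at each point. -/
abbrev Form (h : ℕ) : Type _ := (p : M) → (TangentSpace I p) [⋀^Fin h]→L[ℝ] ℝ

/-- `L × L` matrices whose entries are differential `h`-forms on `M`. -/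
abbrev MatForm (L h : ℕ) : Type _ := Matrix (Fin L) (Fin L) (Form I M h)

variable {I M}

/-- The value `η_P = (η_P^{(ij)})` of a matrix valued form at the point `P`. -/
def MatForm.at {L h : ℕ} (η : MatForm I M L h) (P : M) :
    Matrix (Fin L) (Fin L) ((TangentSpace I P) [⋀^Fin h]→L[ℝ] ℝ) :=
  fun i j => η i j P

variable {E' : Type*} [NormedAddCommGroup E'] [NormedSpace ℝ E']
  {H' : Type*} [TopologicalSpace H'] {I' : ModelWithCorners ℝ E' H'}
  {N : Type*} [TopologicalSpace N] [ChartedSpace H' N]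

/-- Pullback of a form: `(f^*η)_p (v₁, …, v_h) = η_{f p} (df_p v₁, …, df_p v_h)`. At a point `p` it
only depends on `f` near `p`. -/
def Form.pullback {h : ℕ} (f : M → N) (η : Form I' N h) : Form I M h :=
  fun p => (η (f p)).compContinuousLinearMap (mfderiv I I' f p)

/-- Entrywise pullback of a matrix valued form. -/
def MatForm.pullback {L h : ℕ} (f : M → N) (η : MatForm I' N L h) : MatForm I M L h :=
  fun i j => Form.pullback f (η i j)

/-- The differential of a real function, as a `1`-form. -/
def differential (u : M → ℝ) : Form I M 1 :=
  fun p => ContinuousAlternatingMap.ofSubsingleton ℝ (TangentSpace I p) ℝ (0 : Fin 1)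
    (mfderiv I 𝓘(ℝ, ℝ) u p)

/-- Exterior product of two alternating `1`-forms:
`(α ∧ β)(v, w) = α(v) β(w) - α(w) β(v)`. -/
def wedgeOne {V : Type*} [AddCommGroup V] [Module ℝ V] [TopologicalSpace V]
    (α β : V [⋀^Fin 1]→L[ℝ] ℝ) : V [⋀^Fin 2]→L[ℝ] ℝ :=
  let a := (ContinuousAlternatingMap.ofSubsingleton ℝ V ℝ (0 : Fin 1)).symm α
  let b := (ContinuousAlternatingMap.ofSubsingleton ℝ V ℝ (0 : Fin 1)).symm β
  { toFun := fun v => a (v 0) * b (v 1) - a (v 1) * b (v 0)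
    map_update_add' := by
      intro _ v i x y
      fin_cases i <;> simp <;> ring
    map_update_smul' := by
      intro _ v i c x
      fin_cases i <;> simp <;> ring
    cont := by fun_prop
    map_eq_zero_of_eq' := by
      intro v i j hv hij
      fin_cases i <;> fin_cases j <;> simp_all }

/-- Exterior product of two matrix valued `1`-forms:
`(λ ∧ μ)^{(ij)} = ∑ q, λ^{(iq)} ∧ μ^{(qj)}`. -/
def MatForm.wedge {L : ℕ} (lam mu : MatForm I M L 1) : MatForm I M L 2 :=
  fun i j P => ∑ q, wedgeOne (lam i q P) (mu q j P)

end Forms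

/-! ### Regularity and exterior derivative, on manifolds modelled on a normed space -/

section Derivative

variable {E : Type*} [NormedAddCommGroup E] [NormedSpace ℝ E]
  {M : Type*} [TopologicalSpace M] [ChartedSpace E M]

/-- The local representation of a form in the chart `e`: the pullback of `η` by `e.symm`, which is
a form on the open subset `e.target` of `E` (and junk outside). -/
def Form.localRep {h : ℕ} (η : Form 𝓘(ℝ, E) M h) (e : OpenPartialHomeomorph M E) :
    E → E [⋀^Fin h]→L[ℝ] ℝ :=
  Form.pullback (I := 𝓘(ℝ, E)) (M := E) e.symm η

/-- `η` is a form of class `C^k` on the `C^n` manifold `M`: its local representations in all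
`C^n` charts are of class `C^k`. -/
def Form.IsOfClass (n k : WithTop ℕ∞) {h : ℕ} (η : Form 𝓘(ℝ, E) M h) : Prop :=
  ∀ e ∈ IsManifold.maximalAtlas 𝓘(ℝ, E) n M, ContDiffOn ℝ k (η.localRep e) e.target

/-- A matrix valued form is of class `C^k` if all its entries are. -/
def MatForm.IsOfClass (n k : WithTop ℕ∞) {L h : ℕ} (η : MatForm 𝓘(ℝ, E) M L h) : Prop :=
  ∀ i j, (η i j).IsOfClass n k

/-- The exterior derivative of a form, computed at `P` in the preferred chart at `P` (for a `C^1`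
form on a `C^2` manifold, every chart around `P` gives the same value). -/
def Form.d {h : ℕ} (η : Form 𝓘(ℝ, E) M h) : Form 𝓘(ℝ, E) M (h + 1) :=
  fun P => (extDeriv (η.localRep (chartAt E P)) (chartAt E P P)).compContinuousLinearMap
    (mfderiv 𝓘(ℝ, E) 𝓘(ℝ, E) (chartAt E P) P)

/-- Entrywise exterior derivative of a matrix valued form. -/
def MatForm.d {L h : ℕ} (η : MatForm 𝓘(ℝ, E) M L h) : MatForm 𝓘(ℝ, E) M L (h + 1) :=
  fun i j => (η i j).d

end Derivative

/-! ### Superdensity -/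

/-- `P` is an `s`-density point of `A` relative to the `m`-dimensional `C^1` manifold `M`: there is
a `C^1` chart `(W, Φ)` with `P ∈ W` and `ℒ^m (B_r(Φ P) \ Φ(A ∩ W)) = o(r^s)` as `r → 0+`. The set
`A` need not be measurable, `ℒ^m` being the Lebesgue outer measure. -/
def IsDensityPoint (m : ℕ) {M : Type*} [TopologicalSpace M]
    [ChartedSpace (EuclideanSpace ℝ (Fin m)) M] (s : ℝ) (A : Set M) (P : M) : Prop :=
  ∃ e ∈ IsManifold.maximalAtlas 𝓘(ℝ, EuclideanSpace ℝ (Fin m)) 1 M, P ∈ e.source ∧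
    (fun r : ℝ => volume.real (Metric.ball (e P) r \ e '' (A ∩ e.source)))
      =o[𝓝[>] (0 : ℝ)] fun r : ℝ => r ^ s

/-- The set of `s`-density points of `A`. -/
def densityPoints (m : ℕ) {M : Type*} [TopologicalSpace M]
    [ChartedSpace (EuclideanSpace ℝ (Fin m)) M] (s : ℝ) (A : Set M) : Set M :=
  {P | IsDensityPoint m s A P}

/-! ### Matrix Lie subgroups and the Maurer-Cartan form -/

/-- The natural coordinates `(z_{ij})` of `GL(L, ℝ)`, as a point of `ℝ^{L²}`. -/
def glCoord (L : ℕ) (z : GL (Fin L) ℝ) : EuclideanSpace ℝ (Fin L × Fin L) :=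
  WithLp.toLp 2 fun p => (z : Matrix (Fin L) (Fin L) ℝ) p.1 p.2

section

-- Any norm on matrices will do here.
attribute [local instance] Matrix.linftyOpNormedRing Matrix.linftyOpNormedAlgebra

/-- The natural coordinates identify `GL(L, ℝ)` with an open subset of `ℝ^{L²}`. -/
theorem isOpenEmbedding_glCoord (L : ℕ) : IsOpenEmbedding (glCoord L) := by
  have h1 : IsOpenEmbedding (Units.val : GL (Fin L) ℝ → Matrix (Fin L) (Fin L) ℝ) :=
    Units.isOpenEmbedding_val
  let h : Matrix (Fin L) (Fin L) ℝ ≃ₜ EuclideanSpace ℝ (Fin L × Fin L) :=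
    { toFun := fun A => WithLp.toLp 2 fun p => A p.1 p.2
      invFun := fun v => Matrix.of fun i j => v (i, j)
      left_inv := fun _ => rfl
      right_inv := fun _ => rfl
      continuous_toFun := (PiLp.continuous_toLp 2 _).comp
        (continuous_pi fun p => continuous_id.matrix_elem p.1 p.2)
      continuous_invFun := continuous_matrix fun i j => by
        simp only [Matrix.of_apply]
        fun_prop }
  exact h.isOpenEmbedding.comp h1

end

/-- The usual manifold structure of `GL(L, ℝ)`, with the natural coordinates as a global chart. -/
instance glChartedSpace (L : ℕ) :
    ChartedSpace (EuclideanSpace ℝ (Fin L × Fin L)) (GL (Fin L) ℝ) :=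
  (isOpenEmbedding_glCoord L).singletonChartedSpace

/-- The matrix valued `1`-form `γ_z = z⁻¹ dz` on `GL(L, ℝ)`, that is
`γ^{(ij)} = ∑ q, (z⁻¹)_{iq} dz_{qj}`. -/
def glMaurerCartan (L : ℕ) :
    MatForm 𝓘(ℝ, EuclideanSpace ℝ (Fin L × Fin L)) (GL (Fin L) ℝ) L 1 :=
  fun i j z => ∑ q, ((z⁻¹ : GL (Fin L) ℝ) : Matrix (Fin L) (Fin L) ℝ) i q •
    differential (fun w : GL (Fin L) ℝ => (w : Matrix (Fin L) (Fin L) ℝ) q j) z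

/-- The Lie group `G` is a (not necessarily embedded) Lie subgroup of `GL(L, ℝ)` with inclusion
`ι`: the homomorphism `ι` is an injective smooth immersion. -/
structure IsMatrixLieSubgroup (n : ℕ) {L : ℕ} {G : Type*} [TopologicalSpace G]
    [ChartedSpace (EuclideanSpace ℝ (Fin n)) G] [Group G]
    [LieGroup 𝓘(ℝ, EuclideanSpace ℝ (Fin n)) ∞ G] (ι : G →* GL (Fin L) ℝ) : Prop where
  injective : Function.Injective ι
  contMDiff : ContMDiff 𝓘(ℝ, EuclideanSpace ℝ (Fin n)) 𝓘(ℝ, EuclideanSpace ℝ (Fin L × Fin L)) ∞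
    ι
  immersion : ∀ g, Function.Injective
    (mfderiv 𝓘(ℝ, EuclideanSpace ℝ (Fin n)) 𝓘(ℝ, EuclideanSpace ℝ (Fin L × Fin L)) ι g)

/-- The Maurer-Cartan form `Γ_G = ι^*γ` of the Lie subgroup `G` of `GL(L, ℝ)` with inclusion `ι`. -/
def maurerCartan (n : ℕ) {L : ℕ} {G : Type*} [TopologicalSpace G]
    [ChartedSpace (EuclideanSpace ℝ (Fin n)) G] [Group G] (ι : G →* GL (Fin L) ℝ) :
    MatForm 𝓘(ℝ, EuclideanSpace ℝ (Fin n)) G L 1 :=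
  (glMaurerCartan L).pullback ι

/-- The set `{f^*Γ_G = φ|_U}`, as a subset of `M`, for a map `f` defined on the open set `U` (the
values of `f` outside `U` are irrelevant). -/
def agreementSet {m : ℕ} (n : ℕ) {L : ℕ} {M : Type*} [TopologicalSpace M]
    [ChartedSpace (EuclideanSpace ℝ (Fin m)) M] {G : Type*} [TopologicalSpace G]
    [ChartedSpace (EuclideanSpace ℝ (Fin n)) G] [Group G] (ι : G →* GL (Fin L) ℝ)
    (φ : MatForm 𝓘(ℝ, EuclideanSpace ℝ (Fin m)) M L 1) (U : Set M) (f : M → G) : Set M :=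
  {Q ∈ U | ((maurerCartan n ι).pullback f : MatForm 𝓘(ℝ, EuclideanSpace ℝ (Fin m)) M L 1).at Q
    = φ.at Q}

end MCForms

end

noncomputable section

namespace MCForms

/-! ### Closedness of a form that agrees with a differential near a superdensity point -/

section Closed

/-! In a chart, let `F` be the matrix of `ι ∘ f` and `ψ` that of `φ`. Agreement at a point means
`F⁻¹ dF = ψ`, that is `dF = Fψ`. The right side is `C^1`, although `F` is only `C^1` and `dF` cannot
be differentiated.

The analytic core is `closed_at_superdensity_point`: if `du = κ` on a set `A` of which `x₀` is a
`(d+1)`-density point, `d` being the dimension, then `dκ = 0` at `x₀`. Test against a bump `ρ` at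
scale `r`. Since `du` is weakly closed, `∫ dρ ∧ (du - κ) = ∫ ρ dκ` (with a fixed sign convention).
If `dκ ≠ 0` at `x₀`, some component makes the right side at least of order `r^d`. On the left the
integrand lives on `B_{2r} \ A` and is `O(1/r)`, so the integral is `r⁻¹ o(r^(d+1)) = o(r^d)`: a
contradiction. The derivative of the bump costs exactly the one extra power of `r`.

Moreover `dF = Fψ` at `x₀` itself, by continuity. So `0 = d(Fψ) = dF ∧ ψ + F dψ = F (ψ ∧ ψ + dψ)`,
and cancelling the invertible `F` yields the structure equation at every superdensity point in the
domain of `f`. Both claims are contrapositives; the first also uses that the structure equation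
fails on an open set. -/

theorem not_eventually_mul_pow_le_of_isLittleO {δ : ℝ → ℝ} {d : ℕ} {a c : ℝ}
    (hδ : δ =o[𝓝[>] (0 : ℝ)] fun r : ℝ => r ^ d) (ha : 0 < a) (hc : 0 < c) :
    ¬ ∀ᶠ r in 𝓝[>] (0 : ℝ), c * r ^ d ≤ δ (a * r) := by
  intro h
  have ht : Tendsto (fun r : ℝ => a * r) (𝓝[>] 0) (𝓝[>] 0) := by
    refine tendsto_nhdsWithin_iff.2 ⟨?_, ?_⟩
    · have : Tendsto (fun r : ℝ => a * r) (𝓝 0) (𝓝 (a * 0)) := tendsto_id.const_mul a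
      rw [mul_zero] at this
      exact this.mono_left nhdsWithin_le_nhds
    · filter_upwards [self_mem_nhdsWithin] with r hr
      exact mul_pos ha hr
  -- This constant makes the bound at `a * r` equal to half of `c * r ^ d`.
  have hlt := (hδ.comp_tendsto ht).def (c := c / (2 * a ^ d)) (by positivity)
  obtain ⟨r, h1, h2, hr⟩ := (h.and (hlt.and self_mem_nhdsWithin)).exists
  have hr : 0 < r := hr
  have h3 : δ (a * r) ≤ c / 2 * r ^ d := by
    refine (le_abs_self _).trans (h2.trans_eq ?_)
    simp only [Function.comp_apply, Real.norm_eq_abs]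
    rw [abs_of_pos (by positivity), mul_pow]
    field_simp
  have : 0 < c * r ^ d := by positivity
  linarith

variable {E : Type*} [NormedAddCommGroup E] [NormedSpace ℝ E] [FiniteDimensional ℝ E]

/-- Multiplying by a bump supported inside `V` makes local data global without changing its germ, so
that integration by parts over all of `E` applies. -/
theorem exists_contDiff_eventuallyEq {F : Type*} [NormedAddCommGroup F] [NormedSpace ℝ F]
    {u : E → F} {V : Set E} {x : E} {k : ℕ} (hV : IsOpen V) (hx : x ∈ V)
    (hu : ContDiffOn ℝ k u V) : ∃ u' : E → F, ContDiff ℝ k u' ∧ u' =ᶠ[𝓝 x] u := by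
  obtain ⟨ε, hε, hεV⟩ := Metric.isOpen_iff.1 hV x hx
  let χ : ContDiffBump x := ⟨ε / 4, ε / 2, by positivity, by linarith⟩
  refine ⟨fun y => χ y • u y, ?_, ?_⟩
  · rw [contDiff_iff_contDiffAt]
    intro y
    by_cases hy : y ∈ V
    · exact χ.contDiff.contDiffAt.smul (hu.contDiffAt (hV.mem_nhds hy))
    · have hy' : y ∉ tsupport χ := by
        rw [χ.tsupport_eq]
        intro h
        apply hy (hεV _)
        have : dist y x ≤ ε / 2 := h
        exact lt_of_le_of_lt this (by linarith)
      have h0 : (fun z => χ z • u z) =ᶠ[𝓝 y] fun _ => 0 := by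
        filter_upwards [(isClosed_tsupport χ).isOpen_compl.mem_nhds hy'] with z hz
        rw [image_eq_zero_of_notMem_tsupport hz, zero_smul]
      exact contDiffAt_const.congr_of_eventuallyEq h0
  · filter_upwards [χ.eventuallyEq_one] with y hy
    simp [hy]

variable [MeasurableSpace E]

theorem measureReal_ball_pos (μ : Measure E) [μ.IsAddHaarMeasure] (x : E) {r : ℝ} (hr : 0 < r) :
    0 < μ.real (Metric.ball x r) :=
  ENNReal.toReal_pos (Metric.measure_ball_pos μ x hr).ne' measure_ball_lt_top.ne
variable [BorelSpace E] {μ : Measure E} [μ.IsAddHaarMeasure]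

/-- Weak form of `d(du) = 0`. Integrating by parts moves the derivative from `u` to `dρ`, and the
`u` terms cancel by symmetry of the second derivative of `ρ`; hence `C^1` is enough for `u`. -/
theorem integral_bump_mul_curl {u : E → ℝ} {κ : E → E →L[ℝ] ℝ} {ρ : E → ℝ}
    (hu : ContDiff ℝ 1 u) (hκ : ContDiff ℝ 1 κ) (hρ : ContDiff ℝ 2 ρ)
    (hρc : HasCompactSupport ρ) (v w : E) :
    ∫ x, (fderiv ℝ ρ x v * (fderiv ℝ u x w - κ x w)
        - fderiv ℝ ρ x w * (fderiv ℝ u x v - κ x v)) ∂μ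
      = ∫ x, ρ x * (fderiv ℝ κ x v w - fderiv ℝ κ x w v) ∂μ := by
  have hDρ : ContDiff ℝ 1 (fderiv ℝ ρ) := hρ.fderiv_right (by norm_num)
  have hDρv (v : E) : ContDiff ℝ 1 fun x => fderiv ℝ ρ x v := hDρ.clm_apply contDiff_const
  have hκv (v : E) : ContDiff ℝ 1 fun x => κ x v := hκ.clm_apply contDiff_const
  have hcv (v : E) : HasCompactSupport fun x => fderiv ℝ ρ x v :=
    hρc.fderiv_apply (𝕜 := ℝ) v
  have hDDc (v w : E) : HasCompactSupport fun x => fderiv ℝ (fun y => fderiv ℝ ρ y v) x w :=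
    (hcv v).fderiv_apply (𝕜 := ℝ) w
  have hcont {g : E → ℝ} (hg : ContDiff ℝ 1 g) (v : E) : Continuous fun x => fderiv ℝ g x v :=
    (hg.continuous_fderiv one_ne_zero).clm_apply continuous_const
  have hdiff {g : E → ℝ} (hg : ContDiff ℝ 1 g) : Differentiable ℝ g :=
    hg.differentiable one_ne_zero
  have i1 (v w : E) : Integrable (fun x => fderiv ℝ ρ x v * fderiv ℝ u x w) μ :=
    ((hDρv v).continuous.mul (hcont hu w)).integrable_of_hasCompactSupport (hcv v).mul_right
  have i2 (v w : E) : Integrable (fun x => fderiv ℝ ρ x v * κ x w) μ :=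
    ((hDρv v).continuous.mul (hκv w).continuous).integrable_of_hasCompactSupport
      (hcv v).mul_right
  have i3 (v w : E) : Integrable (fun x => ρ x * fderiv ℝ (fun y => κ y w) x v) μ :=
    (hρ.continuous.mul (hcont (hκv w) v)).integrable_of_hasCompactSupport hρc.mul_right
  have e1 (v w : E) : ∫ x, fderiv ℝ ρ x v * fderiv ℝ u x w ∂μ
      = - ∫ x, fderiv ℝ (fun y => fderiv ℝ ρ y v) x w * u x ∂μ :=
    integral_mul_fderiv_eq_neg_fderiv_mul_of_integrable
      (((hcont (hDρv v) w).mul hu.continuous).integrable_of_hasCompactSupport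
        (hDDc v w).mul_right) (i1 v w)
      (((hDρv v).continuous.mul hu.continuous).integrable_of_hasCompactSupport
        (hcv v).mul_right) (fun x _ => hdiff (hDρv v) x) (fun x _ => hdiff hu x)
  have e2 (v w : E) : ∫ x, ρ x * fderiv ℝ (fun y => κ y w) x v ∂μ
      = - ∫ x, fderiv ℝ ρ x v * κ x w ∂μ :=
    integral_mul_fderiv_eq_neg_fderiv_mul_of_integrable (i2 v w) (i3 v w)
      ((hρ.continuous.mul (hκv w).continuous).integrable_of_hasCompactSupport
        hρc.mul_right) (fun x _ => hρ.differentiable two_ne_zero x)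
      (fun x _ => hdiff (hκv w) x)
  have hsymm (x : E) : fderiv ℝ (fun y => fderiv ℝ ρ y v) x w
      = fderiv ℝ (fun y => fderiv ℝ ρ y w) x v := by
    have hd := hDρ.differentiable one_ne_zero x
    rw [fderiv_clm_apply hd (differentiableAt_const v),
      fderiv_clm_apply hd (differentiableAt_const w)]
    simpa using (hρ.contDiffAt.isSymmSndFDerivAt (by simp)) w v
  have hκ' (x v w : E) : fderiv ℝ κ x v w = fderiv ℝ (fun y => κ y w) x v := by
    rw [fderiv_clm_apply (hκ.differentiable one_ne_zero x) (differentiableAt_const w)]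
    simp
  simp only [mul_sub, hκ']
  have e3 := integral_sub ((i1 v w).sub (i2 v w)) ((i1 w v).sub (i2 w v))
  simp only [Pi.sub_apply] at e3
  rw [e3, integral_sub (i1 v w) (i2 v w), integral_sub (i1 w v) (i2 w v),
    integral_sub (i3 v w) (i3 w v), e1, e1, e2, e2]
  simp only [hsymm]
  ring

theorem measureReal_ball_eq (μ : Measure E) [μ.IsAddHaarMeasure] (x : E) {r : ℝ} (hr : 0 < r) :
    μ.real (Metric.ball x r) = r ^ Module.finrank ℝ E * μ.real (Metric.ball (0 : E) 1) := by
  rw [measureReal_def, Measure.addHaar_ball_of_pos μ x hr, ENNReal.toReal_mul,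
    ENNReal.toReal_ofReal (by positivity), measureReal_def]

open Module in
-- If `A` missed a neighbourhood of `x`, small balls would lie in the complement, and their measure
-- has order `r ^ d`, too large for `o(r ^ (d + 1))`.
theorem mem_closure_of_superdensity {A : Set E} {x : E}
    (hA : (fun r : ℝ => μ.real (Metric.ball x r \ A)) =o[𝓝[>] (0 : ℝ)]
      fun r : ℝ => r ^ (finrank ℝ E + 1)) : x ∈ closure A := by
  by_contra hx
  obtain ⟨ε, hε, hεA⟩ := Metric.isOpen_iff.1 (isClosed_closure (s := A)).isOpen_compl x hx
  refine not_eventually_mul_pow_le_of_isLittleO hA one_pos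
    (c := μ.real (Metric.ball (0 : E) 1)) (measureReal_ball_pos μ _ one_pos) ?_
  filter_upwards [Ioo_mem_nhdsGT (lt_min hε one_pos)] with r ⟨hr, hr'⟩
  have hr1 : r < 1 := hr'.trans_le (min_le_right _ _)
  have hb : Metric.ball x (1 * r) \ A = Metric.ball x r := by
    rw [one_mul]
    refine sdiff_eq_left.2 (Set.disjoint_left.2 fun y hy hyA => ?_)
    exact hεA (Metric.ball_subset_ball (hr'.le.trans (min_le_left _ _)) hy) (subset_closure hyA)
  rw [hb, measureReal_ball_eq μ x hr, mul_comm]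
  gcongr ?_ * _
  exact pow_le_pow_of_le_one hr.le hr1.le (Nat.le_succ _)

open Module in
-- The scaling argument, for one sign of the curl; exchanging `v` and `w` gives the other sign.
theorem fderiv_apply_le_of_superdensity {u : E → ℝ} {κ : E → E →L[ℝ] ℝ} {A : Set E} {x₀ : E}
    (hu : ContDiff ℝ 1 u) (hκ : ContDiff ℝ 1 κ)
    (hAκ : ∀ᶠ x in 𝓝 x₀, x ∈ A → fderiv ℝ u x = κ x)
    (hA : (fun r : ℝ => μ.real (Metric.ball x₀ r \ A)) =o[𝓝[>] (0 : ℝ)]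
      fun r : ℝ => r ^ (finrank ℝ E + 1)) (v w : E) :
    fderiv ℝ κ x₀ v w ≤ fderiv ℝ κ x₀ w v := by
  by_contra! hlt
  set h : E → ℝ := fun x => fderiv ℝ κ x v w - fderiv ℝ κ x w v with hh
  set θ : E → E →L[ℝ] ℝ := fun x => fderiv ℝ u x - κ x with hθ
  have hh_cont : Continuous h := by
    have := hκ.continuous_fderiv one_ne_zero
    fun_prop
  have hθ_cont : Continuous θ := (hu.continuous_fderiv one_ne_zero).sub hκ.continuous
  set c := h x₀ / 2 with hc
  have hc0 : 0 < c := half_pos (sub_pos.2 hlt)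
  let ρ : ContDiffBump (0 : E) := ⟨1, 2, one_pos, one_lt_two⟩
  have hρ_diff : ContDiff ℝ 2 ρ := ρ.contDiff
  obtain ⟨C, hC⟩ : ∃ C, ∀ x, ‖fderiv ℝ ρ x‖ ≤ C :=
    (ρ.hasCompactSupport.fderiv (𝕜 := ℝ)).exists_bound_of_continuous
      (hρ_diff.continuous_fderiv two_ne_zero)
  have hC0 : 0 ≤ C := (norm_nonneg _).trans (hC 0)
  set T := ‖θ x₀‖ + 1
  have hT0 : 0 < T := by positivity
  set K := 2 * C * ‖v‖ * ‖w‖ * T + 1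
  have hK0 : 0 < K := by positivity
  set b := μ.real (Metric.ball (0 : E) 1)
  have hb0 : 0 < b := measureReal_ball_pos μ _ one_pos
  obtain ⟨ε, hε, hεs⟩ := Metric.eventually_nhds_iff_ball.1
    (hAκ.and ((hh_cont.continuousAt.eventually_const_lt (half_lt_self (sub_pos.2 hlt))).and
      (hθ_cont.norm.continuousAt.eventually_lt_const (lt_add_one ‖θ x₀‖))))
  -- The bump at scale `r` is supported in the ball of radius `2 * r`, and the two bounds below
  -- compare as `c * b * r ^ d ≤ r⁻¹ * K * μ(B_{2r} \ A)`.
  refine not_eventually_mul_pow_le_of_isLittleO hA two_pos (c := c * b / K) (by positivity) ?_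
  filter_upwards [Ioo_mem_nhdsGT (half_pos hε)] with r ⟨hr, hr'⟩
  have hrn : r ≠ 0 := hr.ne'
  have hsub : Metric.ball x₀ (2 * r) ⊆ Metric.ball x₀ ε :=
    Metric.ball_subset_ball (by linarith)
  set σ : E → ℝ := fun x => ρ (r⁻¹ • (x - x₀)) with hσ
  have hσ_diff : ContDiff ℝ 2 σ :=
    hρ_diff.comp (contDiff_const.smul (contDiff_id.sub contDiff_const))
  have hdist (x : E) : dist (r⁻¹ • (x - x₀)) 0 = r⁻¹ * dist x x₀ := by
    rw [dist_zero_right, norm_smul, dist_eq_norm, Real.norm_of_nonneg (inv_nonneg.2 hr.le)]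
  have hσ_supp : Function.support σ = Metric.ball x₀ (2 * r) := by
    ext x
    have : x ∈ Function.support σ ↔ r⁻¹ • (x - x₀) ∈ Function.support ρ := Iff.rfl
    rw [this, ρ.support_eq, Metric.mem_ball, hdist, Metric.mem_ball, inv_mul_lt_iff₀ hr, mul_comm]
  have hσ_cs : HasCompactSupport σ := by
    refine HasCompactSupport.of_support_subset_isCompact (isCompact_closedBall x₀ (2 * r)) ?_
    rw [hσ_supp]
    exact Metric.ball_subset_closedBall
  have hσ_one (x : E) (hx : x ∈ Metric.ball x₀ r) : σ x = 1 := by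
    refine ρ.one_of_mem_closedBall ?_
    rw [Metric.mem_closedBall, hdist, inv_mul_le_iff₀ hr, mul_one]
    exact (Metric.mem_ball.1 hx).le
  have hσ_fderiv (x z : E) : |fderiv ℝ σ x z| ≤ r⁻¹ * C * ‖z‖ := by
    have hin : HasFDerivAt (fun x : E => r⁻¹ • (x - x₀)) (r⁻¹ • ContinuousLinearMap.id ℝ E) x :=
      ((hasFDerivAt_id x).sub_const x₀).const_smul r⁻¹
    have := ((hρ_diff.differentiable two_ne_zero
      (r⁻¹ • (x - x₀))).hasFDerivAt.comp x hin).fderiv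
    have h2 : fderiv ℝ σ x z = r⁻¹ * fderiv ℝ ρ (r⁻¹ • (x - x₀)) z := by
      rw [show σ = ρ ∘ fun x : E => r⁻¹ • (x - x₀) from rfl, this]
      simp
    rw [h2, abs_mul, abs_of_pos (inv_pos.2 hr), mul_assoc]
    gcongr
    exact ContinuousLinearMap.le_of_opNorm_le _ (hC _) z
  -- A zero of the nonnegative `σ` is a minimum; this covers the bounding sphere as well.
  have hσ_fderiv_zero (x : E) (hx : x ∉ Metric.ball x₀ (2 * r)) : fderiv ℝ σ x = 0 := by
    have : IsMinOn σ univ x := by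
      intro y _
      have h0 : σ x = 0 := by rwa [← hσ_supp, Function.notMem_support] at hx
      simpa [h0] using ρ.nonneg
    exact (this.isLocalMin univ_mem).fderiv_eq_zero
  have key := integral_bump_mul_curl (μ := μ) hu hκ hσ_diff hσ_cs v w
  -- lower bound for the right hand side
  have hlow : c * (b * r ^ finrank ℝ E) ≤ ∫ x, σ x * h x ∂μ := by
    have hi : Integrable (fun x => σ x * h x) μ :=
      (hσ_diff.continuous.mul hh_cont).integrable_of_hasCompactSupport hσ_cs.mul_right
    have hi' : Integrable ((Metric.ball x₀ r).indicator fun _ => c) μ :=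
      (integrable_indicator_iff measurableSet_ball).2
        (integrableOn_const (measure_ball_lt_top).ne)
    have : ∫ x, (Metric.ball x₀ r).indicator (fun _ => c) x ∂μ ≤ ∫ x, σ x * h x ∂μ := by
      refine integral_mono hi' hi fun x => ?_
      by_cases hx : x ∈ Metric.ball x₀ r
      · simp only [indicator_of_mem hx, hσ_one x hx, one_mul]
        exact (hεs x (hsub (Metric.ball_subset_ball (by linarith) hx))).2.1.le
      · simp only [indicator_of_notMem hx]
        by_cases hx2 : x ∈ Metric.ball x₀ (2 * r)
        · exact mul_nonneg ρ.nonneg (hc0.trans (hεs x (hsub hx2)).2.1).le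
        · rw [← hσ_supp, Function.notMem_support] at hx2
          simp [hx2]
    rw [integral_indicator measurableSet_ball, setIntegral_const,
      measureReal_ball_eq μ x₀ hr, smul_eq_mul] at this
    linarith
  -- upper bound for the left hand side
  have hup : ‖∫ x, (fderiv ℝ σ x v * (fderiv ℝ u x w - κ x w)
        - fderiv ℝ σ x w * (fderiv ℝ u x v - κ x v)) ∂μ‖
      ≤ (r⁻¹ * K) * μ.real (Metric.ball x₀ (2 * r) \ A) := by
    -- The integrand vanishes on `A` near `x₀` and off the ball; restricting to the difference does
    -- not require `A` to be measurable.
    rw [← setIntegral_eq_integral_of_forall_compl_eq_zero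
      (s := Metric.ball x₀ (2 * r) \ A)]
    · refine norm_setIntegral_le_of_norm_le_const
        ((measure_mono sdiff_subset).trans_lt measure_ball_lt_top) fun x hx => ?_
      have hTx : ‖θ x‖ ≤ T := (hεs x (hsub hx.1)).2.2.le
      have hb (z : E) : |fderiv ℝ u x z - κ x z| ≤ T * ‖z‖ :=
        ContinuousLinearMap.le_of_opNorm_le (θ x) hTx z
      calc ‖fderiv ℝ σ x v * (fderiv ℝ u x w - κ x w)
            - fderiv ℝ σ x w * (fderiv ℝ u x v - κ x v)‖
          ≤ |fderiv ℝ σ x v| * |fderiv ℝ u x w - κ x w|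
            + |fderiv ℝ σ x w| * |fderiv ℝ u x v - κ x v| := by
              simpa only [Real.norm_eq_abs, abs_mul] using norm_sub_le
                (fderiv ℝ σ x v * (fderiv ℝ u x w - κ x w))
                (fderiv ℝ σ x w * (fderiv ℝ u x v - κ x v))
        _ ≤ (r⁻¹ * C * ‖v‖) * (T * ‖w‖) + (r⁻¹ * C * ‖w‖) * (T * ‖v‖) := by
              gcongr
              exacts [hσ_fderiv x v, hb w, hσ_fderiv x w, hb v]
        _ = r⁻¹ * (2 * C * ‖v‖ * ‖w‖ * T) := by ring
        _ ≤ r⁻¹ * K := by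
              have := inv_pos.2 hr
              gcongr
              exact (lt_add_one _).le
    · intro x hx
      by_cases hx2 : x ∈ Metric.ball x₀ (2 * r)
      · have hxA : x ∈ A := by by_contra hxA; exact hx ⟨hx2, hxA⟩
        simp [(hεs x (hsub hx2)).1 hxA]
      · simp [hσ_fderiv_zero x hx2]
  have hfin := (hlow.trans_eq key.symm).trans ((le_abs_self _).trans hup)
  rw [div_mul_eq_mul_div, div_le_iff₀ hK0, pow_succ]
  calc c * b * (r ^ finrank ℝ E * r) = c * (b * r ^ finrank ℝ E) * r := by ring
    _ ≤ r⁻¹ * K * μ.real (Metric.ball x₀ (2 * r) \ A) * r := by gcongr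
    _ = μ.real (Metric.ball x₀ (2 * r) \ A) * K := by field_simp

open Module in
/-- If `du = κ` on a set of which `x₀` is a superdensity point, then `du = κ` at `x₀` and `κ` is
closed at `x₀`. -/
theorem closed_at_superdensity_point {u : E → ℝ} {κ : E → E →L[ℝ] ℝ} {A V : Set E} {x₀ : E}
    (hV : IsOpen V) (hx₀ : x₀ ∈ V) (hu : ContDiffOn ℝ 1 u V) (hκ : ContDiffOn ℝ 1 κ V)
    (hAκ : ∀ x ∈ V, x ∈ A → fderiv ℝ u x = κ x)
    (hA : (fun r : ℝ => μ.real (Metric.ball x₀ r \ A)) =o[𝓝[>] (0 : ℝ)]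
      fun r : ℝ => r ^ (finrank ℝ E + 1)) :
    fderiv ℝ u x₀ = κ x₀ ∧ ∀ v w, fderiv ℝ κ x₀ v w = fderiv ℝ κ x₀ w v := by
  obtain ⟨u', hu', hue⟩ := exists_contDiff_eventuallyEq (k := 1) hV hx₀ (by exact_mod_cast hu)
  obtain ⟨κ', hκ', hκe⟩ := exists_contDiff_eventuallyEq (k := 1) hV hx₀ (by exact_mod_cast hκ)
  have hAκ' : ∀ᶠ x in 𝓝 x₀, x ∈ A → fderiv ℝ u' x = κ' x := by
    filter_upwards [hue.fderiv (𝕜 := ℝ), hκe, hV.mem_nhds hx₀] with x h1 h2 hx hxA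
    rw [h1, h2, hAκ x hx hxA]
  have hu1 : ContDiff ℝ 1 u' := by exact_mod_cast hu'
  have hκ1 : ContDiff ℝ 1 κ' := by exact_mod_cast hκ'
  constructor
  · rw [← hue.fderiv_eq, ← hκe.eq_of_nhds]
    have hf : ∃ᶠ x in 𝓝 x₀, fderiv ℝ u' x = κ' x :=
      ((mem_closure_iff_frequently.1 (mem_closure_of_superdensity hA)).and_eventually
        hAκ').mono fun x hx => hx.2 hx.1
    have hcl : IsClosed {x | fderiv ℝ u' x = κ' x} :=
      isClosed_eq (hu1.continuous_fderiv one_ne_zero) hκ1.continuous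
    exact hcl.closure_eq.subset (mem_closure_iff_frequently.2 hf)
  · intro v w
    rw [← hκe.fderiv_eq]
    exact le_antisymm (fderiv_apply_le_of_superdensity hu1 hκ1 hAκ' hA v w)
      (fderiv_apply_le_of_superdensity hu1 hκ1 hAκ' hA w v)

end Closed

/-! ### Invariance of superdensity under local diffeomorphisms -/

section Transfer

variable {E : Type*} [NormedAddCommGroup E] [NormedSpace ℝ E] [FiniteDimensional ℝ E]
  [MeasurableSpace E] [BorelSpace E] {μ : Measure E} [μ.IsAddHaarMeasure]

open scoped NNReal in
-- Near `y₀` the map `τ` is Lipschitz, so `B_r(y₀) \ A₀` lies in the `σ`-image of `B_{cr}(τ y₀) \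
-- A₁`, and `σ` enlarges outer measure by a bounded factor at most.
theorem superdensity_of_strictDiff {σ τ : E → E} {σ' τ' : E →L[ℝ] E} {y₀ : E} {A₀ A₁ : Set E}
    {d : ℕ} (hτ : HasStrictFDerivAt τ τ' y₀) (hσ : HasStrictFDerivAt σ σ' (τ y₀))
    (hστ : ∀ᶠ z in 𝓝 y₀, σ (τ z) = z) (hA : ∀ᶠ z in 𝓝 y₀, τ z ∈ A₁ → z ∈ A₀)
    (h : (fun r : ℝ => μ.real (Metric.ball (τ y₀) r \ A₁)) =o[𝓝[>] (0 : ℝ)]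
      fun r : ℝ => r ^ d) :
    (fun r : ℝ => μ.real (Metric.ball y₀ r \ A₀)) =o[𝓝[>] (0 : ℝ)] fun r : ℝ => r ^ d := by
  obtain ⟨K, t, ht, hK⟩ := hτ.exists_lipschitzOnWith
  set c : ℝ := K + 1
  have hc : 0 < c := by positivity
  set m : ℝ≥0 := Real.toNNReal |σ'.det| + 1
  have hm : ENNReal.ofReal |σ'.det| < m := by
    rw [ENNReal.ofReal, ENNReal.coe_lt_coe]
    exact lt_add_one _
  -- A map `η`-close to `σ'` on an arbitrary set enlarges its measure by at most `m`, provided `m`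
  -- strictly exceeds `|det σ'|`.
  obtain ⟨η, hη, hη0⟩ :=
    ((addHaar_image_le_mul_of_det_lt μ σ' hm).and self_mem_nhdsWithin).exists
  obtain ⟨N, hN, hσN⟩ := hσ.approximates_deriv_on_nhds (Or.inr hη0)
  obtain ⟨ε₁, hε₁, hb₁⟩ := Metric.mem_nhds_iff.1 hN
  obtain ⟨ε₀, hε₀, hb₀⟩ := Metric.eventually_nhds_iff_ball.1 (hστ.and (hA.and ht))
  have hle : ∀ᶠ r in 𝓝[>] (0 : ℝ), μ.real (Metric.ball y₀ r \ A₀)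
      ≤ m * μ.real (Metric.ball (τ y₀) (c * r) \ A₁) := by
    filter_upwards [Ioo_mem_nhdsGT (lt_min hε₀ (div_pos hε₁ hc))] with r ⟨hr, hr'⟩
    have hr0 : r ≤ ε₀ := hr'.le.trans (min_le_left _ _)
    have hr1 : c * r ≤ ε₁ := by
      have := hr'.le.trans (min_le_right _ _)
      rw [le_div_iff₀ hc] at this
      linarith
    have hfin : μ (Metric.ball (τ y₀) (c * r) \ A₁) ≠ ⊤ :=
      ((measure_mono sdiff_subset).trans_lt measure_ball_lt_top).ne
    have hsub : Metric.ball y₀ r \ A₀ ⊆ σ '' (Metric.ball (τ y₀) (c * r) \ A₁) := by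
      rintro z ⟨hz, hzA⟩
      obtain ⟨h1, h2, h3⟩ := hb₀ z (Metric.ball_subset_ball hr0 hz)
      refine ⟨τ z, ⟨?_, fun hz1 => hzA (h2 hz1)⟩, h1⟩
      calc dist (τ z) (τ y₀) ≤ K * dist z y₀ := hK.dist_le_mul z h3 y₀ (mem_of_mem_nhds ht)
        _ ≤ c * dist z y₀ := by gcongr; exact (lt_add_one _).le
        _ < c * r := by gcongr; exact hz
    have := (measure_mono hsub).trans (hη _ σ (hσN.mono_set fun z hz =>
      hb₁ (Metric.ball_subset_ball hr1 hz.1)))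
    calc μ.real (Metric.ball y₀ r \ A₀)
        ≤ ((m : ENNReal) * μ (Metric.ball (τ y₀) (c * r) \ A₁)).toReal :=
          ENNReal.toReal_mono (ENNReal.mul_ne_top ENNReal.coe_ne_top hfin) this
      _ = m * μ.real (Metric.ball (τ y₀) (c * r) \ A₁) := by
          rw [ENNReal.toReal_mul, measureReal_def]; rfl
  have htend : Tendsto (fun r : ℝ => c * r) (𝓝[>] 0) (𝓝[>] 0) := by
    refine tendsto_nhdsWithin_iff.2 ⟨?_, ?_⟩
    · have : Tendsto (fun r : ℝ => c * r) (𝓝 0) (𝓝 (c * 0)) := tendsto_id.const_mul c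
      rw [mul_zero] at this
      exact this.mono_left nhdsWithin_le_nhds
    · filter_upwards [self_mem_nhdsWithin] with r hr
      exact mul_pos hc hr
  have hO : (fun r : ℝ => μ.real (Metric.ball y₀ r \ A₀)) =O[𝓝[>] (0 : ℝ)]
      fun r : ℝ => μ.real (Metric.ball (τ y₀) (c * r) \ A₁) := by
    refine Asymptotics.IsBigO.of_bound m ?_
    filter_upwards [hle] with r hr
    rwa [Real.norm_of_nonneg measureReal_nonneg, Real.norm_of_nonneg measureReal_nonneg]
  refine (hO.trans_isLittleO (h.comp_tendsto htend)).trans_isBigO ?_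
  have : (fun r : ℝ => (c * r) ^ d) = fun r : ℝ => c ^ d * r ^ d := by
    ext r; rw [mul_pow]
  simp only [Function.comp_def, this]
  exact Asymptotics.isBigO_const_mul_self _ _ _

end Transfer

/-! ### The structure equation at superdensity points, in coordinates -/

section Coordinates

variable {E : Type*} [NormedAddCommGroup E] [NormedSpace ℝ E]

/-- An alternating `1`-form, as a linear form. -/
def toLinearForm : (E [⋀^Fin 1]→L[ℝ] ℝ) ≃L[ℝ] (E →L[ℝ] ℝ) :=
  (ContinuousAlternatingMap.ofSubsingletonLIE (𝕜 := ℝ) (E := E) (F := ℝ) (0 : Fin 1)).symm.toContinuousLinearEquiv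

theorem toLinearForm_apply (α : E [⋀^Fin 1]→L[ℝ] ℝ) (v : E) :
    toLinearForm α v = α fun _ => v := rfl

theorem apply_eq_toLinearForm (α : E [⋀^Fin 1]→L[ℝ] ℝ) (v : Fin 1 → E) :
    α v = toLinearForm α (v 0) := by
  rw [toLinearForm_apply]
  congr 1
  ext i
  rw [Subsingleton.elim i 0]

theorem wedgeOne_apply (α β : E [⋀^Fin 1]→L[ℝ] ℝ) (v : Fin 2 → E) :
    wedgeOne α β v = toLinearForm α (v 0) * toLinearForm β (v 1)
      - toLinearForm α (v 1) * toLinearForm β (v 0) := rfl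

theorem sum_smul_ofSubsingleton_apply {ι : Type*} [Fintype ι] (c : ι → ℝ) (T : ι → E →L[ℝ] ℝ)
    (v : Fin 1 → E) :
    (∑ q, c q • ContinuousAlternatingMap.ofSubsingleton ℝ E ℝ (0 : Fin 1) (T q)) v
      = ∑ q, c q * T q (v 0) := by
  simp

theorem extDeriv_oneForm_apply {η : E → E [⋀^Fin 1]→L[ℝ] ℝ} {x : E}
    (h : DifferentiableAt ℝ η x) (v : Fin 2 → E) :
    extDeriv η x v = fderiv ℝ (fun y => toLinearForm (η y)) x (v 0) (v 1)
      - fderiv ℝ (fun y => toLinearForm (η y)) x (v 1) (v 0) := by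
  have h' : DifferentiableAt ℝ (fun y => toLinearForm (η y)) x :=
    (toLinearForm (E := E)).differentiableAt.comp x h
  have key (v w : E) : fderiv ℝ (fun y => toLinearForm (η y)) x v w
      = fderiv ℝ (fun y => toLinearForm (η y) w) x v := by
    rw [fderiv_clm_apply h' (differentiableAt_const w)]
    simp
  rw [extDeriv_apply h, Fin.sum_univ_two, key, key]
  simp only [apply_eq_toLinearForm]
  simp [Fin.removeNth, sub_eq_add_neg]

/-- Naturality of the wedge under pullback, used with `T` the differential of a chart. -/
theorem neg_sum_wedgeOne_apply_comp {ι : Type*} [Fintype ι] {α β α' β' : ι → E [⋀^Fin 1]→L[ℝ] ℝ}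
    {T : E → E} (hα : ∀ q v, toLinearForm (α' q) (T v) = toLinearForm (α q) v)
    (hβ : ∀ q v, toLinearForm (β' q) (T v) = toLinearForm (β q) v) (v : Fin 2 → E) :
    (-∑ q, wedgeOne (α' q) (β' q)) (fun k => T (v k)) = (-∑ q, wedgeOne (α q) (β q)) v := by
  simp only [ContinuousAlternatingMap.neg_apply, ContinuousAlternatingMap.sum_apply,
    wedgeOne_apply, hα, hβ]

theorem continuousOn_structure_equation {L : ℕ}
    {ψ : Fin L → Fin L → E → E [⋀^Fin 1]→L[ℝ] ℝ} {V : Set E} (hV : IsOpen V)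
    (hψ : ∀ i j, ContDiffOn ℝ 1 (ψ i j) V) (i j : Fin L) (v : Fin 2 → E) :
    ContinuousOn (fun x => (extDeriv (ψ i j) x + ∑ q, wedgeOne (ψ i q x) (ψ q j x)) v) V := by
  have haC (i j) : ContDiffOn ℝ 1 (fun x => toLinearForm (ψ i j x)) V :=
    (toLinearForm (E := E)).contDiff.comp_contDiffOn (hψ i j)
  have ha (i j) (v : E) : ContinuousOn (fun x => toLinearForm (ψ i j x) v) V :=
    (haC i j).continuousOn.clm_apply continuousOn_const
  have hd (v w : E) : ContinuousOn
      (fun x => fderiv ℝ (fun y => toLinearForm (ψ i j y)) x v w) V :=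
    (((haC i j).continuousOn_fderiv_of_isOpen hV le_rfl).clm_apply
      continuousOn_const).clm_apply continuousOn_const
  refine (((hd (v 0) (v 1)).sub (hd (v 1) (v 0))).add (continuousOn_finsetSum Finset.univ
    fun q _ => ((ha i q (v 0)).mul (ha q j (v 1))).sub
      ((ha i q (v 1)).mul (ha q j (v 0))))).congr fun x hx => ?_
  rw [ContinuousAlternatingMap.add_apply, ContinuousAlternatingMap.sum_apply,
    extDeriv_oneForm_apply
      (((hψ i j).contDiffAt (hV.mem_nhds hx)).differentiableAt one_ne_zero)]
  rfl

variable [FiniteDimensional ℝ E]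
  [MeasurableSpace E] [BorelSpace E] {μ : Measure E} [μ.IsAddHaarMeasure]

open Module in
-- Each entry of `Fψ` is closed at `x₀`; the product rule, with `dF = Fψ` substituted, turns this
-- into `F (dψ + ψ ∧ ψ) = 0`.
theorem structure_equation_at_superdensity_point {L : ℕ} {F : Fin L → Fin L → E → ℝ}
    {ψ : Fin L → Fin L → E → E [⋀^Fin 1]→L[ℝ] ℝ} {A V : Set E} {x₀ : E}
    (hV : IsOpen V) (hx₀ : x₀ ∈ V) (hF : ∀ i j, ContDiffOn ℝ 1 (F i j) V)
    (hψ : ∀ i j, ContDiffOn ℝ 1 (ψ i j) V)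
    (hAF : ∀ x ∈ V, x ∈ A → ∀ i j v,
      fderiv ℝ (F i j) x v = ∑ q, F i q x * toLinearForm (ψ q j x) v)
    (hA : (fun r : ℝ => μ.real (Metric.ball x₀ r \ A)) =o[𝓝[>] (0 : ℝ)]
      fun r : ℝ => r ^ (finrank ℝ E + 1))
    (hunit : IsUnit (Matrix.of fun i j => F i j x₀)) (i j : Fin L) :
    extDeriv (ψ i j) x₀ + ∑ q, wedgeOne (ψ i q x₀) (ψ q j x₀) = 0 := by
  set a : Fin L → Fin L → E → E →L[ℝ] ℝ := fun i j x => toLinearForm (ψ i j x) with ha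
  have haC (i j) : ContDiffOn ℝ 1 (a i j) V := (toLinearForm (E := E)).contDiff.comp_contDiffOn (hψ i j)
  have hclosed (i j) := closed_at_superdensity_point (μ := μ) (u := F i j)
    (κ := fun x => ∑ q, F i q x • a q j x) hV hx₀ (hF i j)
    (ContDiffOn.sum fun q _ => (hF i q).smul (haC q j))
    (fun x hx hxA => by
      ext v
      rw [hAF x hx hxA]
      simp [ha]) hA
  -- The point `x₀` need not belong to `A`; equality there comes from the closure argument.
  have hFd (i j) : HasFDerivAt (F i j) (∑ q, F i q x₀ • a q j x₀) x₀ := by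
    rw [← (hclosed i j).1]
    exact (((hF i j).contDiffAt (hV.mem_nhds hx₀)).differentiableAt one_ne_zero).hasFDerivAt
  have had (i j) : HasFDerivAt (a i j) (fderiv ℝ (a i j) x₀) x₀ :=
    (((haC i j).contDiffAt (hV.mem_nhds hx₀)).differentiableAt one_ne_zero).hasFDerivAt
  have hκd (i j) (v w : E) : fderiv ℝ (fun x => ∑ q, F i q x • a q j x) x₀ v w
      = ∑ q, F i q x₀ * (fderiv ℝ (a q j) x₀ v w + ∑ p, a q p x₀ v * a p j x₀ w) := by
    have hd : HasFDerivAt (fun x => ∑ q, F i q x • a q j x) _ x₀ :=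
      HasFDerivAt.fun_sum fun q _ => (hFd i q).smul (had q j)
    rw [hd.fderiv]
    simp only [sum_apply, add_apply, smul_apply, ContinuousLinearMap.smulRight_apply, smul_eq_mul,
      Finset.sum_add_distrib, mul_add, Finset.mul_sum, Finset.sum_mul]
    congr 1
    rw [Finset.sum_comm]
    simp only [mul_assoc]
  ext v
  -- The matrix of `dψ + ψ ∧ ψ` at `x₀`, evaluated on `(v 0, v 1)`.
  set W : Matrix (Fin L) (Fin L) ℝ := fun q j =>
    (fderiv ℝ (a q j) x₀ (v 0) (v 1) - fderiv ℝ (a q j) x₀ (v 1) (v 0))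
      + ∑ p, (a q p x₀ (v 0) * a p j x₀ (v 1) - a q p x₀ (v 1) * a p j x₀ (v 0)) with hW
  have hFW : (Matrix.of fun i j => F i j x₀) * W = 0 := by
    ext i j
    have := (hclosed i j).2 (v 0) (v 1)
    rw [hκd, hκd, ← sub_eq_zero, ← Finset.sum_sub_distrib] at this
    rw [Matrix.mul_apply, Matrix.zero_apply, ← this]
    refine Finset.sum_congr rfl fun q _ => ?_
    simp only [hW, Finset.sum_sub_distrib, Matrix.of_apply]
    ring
  have hW0 : W = 0 := by
    obtain ⟨u, hu⟩ := hunit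
    rw [← hu] at hFW
    simpa using congrArg (fun X => (↑u⁻¹ : Matrix (Fin L) (Fin L) ℝ) * X) hFW
  have hij : W i j = 0 := by rw [hW0]; rfl
  rw [ContinuousAlternatingMap.add_apply, extDeriv_oneForm_apply
    (((hψ i j).contDiffAt (hV.mem_nhds hx₀)).differentiableAt one_ne_zero)]
  rw [ContinuousAlternatingMap.sum_apply]
  simp only [wedgeOne_apply]
  exact hij

end Coordinates

/-! ### Reduction to coordinates -/

section Manifold

variable {m n L : ℕ}
  {M : Type*} [TopologicalSpace M] [ChartedSpace (EuclideanSpace ℝ (Fin m)) M]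
  {G : Type*} [TopologicalSpace G] [ChartedSpace (EuclideanSpace ℝ (Fin n)) G] [Group G]

/-- Density is defined through some `C^1` chart; transition maps are strictly differentiable, so it
transfers to the chart in which the forms are studied. -/
theorem IsDensityPoint.isLittleO_chart [IsManifold 𝓘(ℝ, EuclideanSpace ℝ (Fin m)) 1 M]
    {A : Set M} {Q : M} (h : IsDensityPoint m ((m : ℝ) + 1) A Q)
    {e : OpenPartialHomeomorph M (EuclideanSpace ℝ (Fin m))}
    (he : e ∈ IsManifold.maximalAtlas 𝓘(ℝ, EuclideanSpace ℝ (Fin m)) 1 M) (hQ : Q ∈ e.source) :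
    (fun r : ℝ => volume.real (Metric.ball (e Q) r \ e '' (A ∩ e.source)))
      =o[𝓝[>] (0 : ℝ)] fun r : ℝ => r ^ (m + 1) := by
  obtain ⟨e₁, he₁, hQ₁, h⟩ := h
  have hpow : (fun r : ℝ => r ^ ((m : ℝ) + 1)) = fun r : ℝ => r ^ (m + 1) := by
    ext r
    exact_mod_cast Real.rpow_natCast r (m + 1)
  rw [hpow] at h
  have trans_strict {e e' : OpenPartialHomeomorph M (EuclideanSpace ℝ (Fin m))}
      (he : e ∈ IsManifold.maximalAtlas 𝓘(ℝ, EuclideanSpace ℝ (Fin m)) 1 M)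
      (he' : e' ∈ IsManifold.maximalAtlas 𝓘(ℝ, EuclideanSpace ℝ (Fin m)) 1 M)
      (hQ : Q ∈ e.source) (hQ' : Q ∈ e'.source) :
      HasStrictFDerivAt (e' ∘ e.symm) (fderiv ℝ (e' ∘ e.symm) (e Q)) (e Q) := by
    have h1 : ContMDiffAt 𝓘(ℝ, EuclideanSpace ℝ (Fin m)) 𝓘(ℝ, EuclideanSpace ℝ (Fin m)) 1
        (e' ∘ e.symm) (e Q) := by
      refine ContMDiffAt.comp (e Q) ?_
        (contMDiffAt_symm_of_mem_maximalAtlas he (e.map_source hQ))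
      rw [e.left_inv hQ]
      exact contMDiffAt_of_mem_maximalAtlas he' hQ'
    exact (contMDiffAt_iff_contDiffAt.1 h1).hasStrictFDerivAt one_ne_zero
  have hτQ : (e₁ ∘ e.symm) (e Q) = e₁ Q := by simp [e.left_inv hQ]
  have hcont : Tendsto e.symm (𝓝 (e Q)) (𝓝 Q) := by
    have := e.continuousAt_symm (e.map_source hQ)
    rwa [ContinuousAt, e.left_inv hQ] at this
  have hev : ∀ᶠ z in 𝓝 (e Q), z ∈ e.target ∧ e.symm z ∈ e₁.source :=
    (e.open_target.eventually_mem (e.map_source hQ)).and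
      (hcont.eventually (e₁.open_source.eventually_mem hQ₁))
  refine superdensity_of_strictDiff (σ := e ∘ e₁.symm) (τ := e₁ ∘ e.symm)
    (A₁ := e₁ '' (A ∩ e₁.source)) (trans_strict he he₁ hQ hQ₁)
    (hτQ ▸ trans_strict he₁ he hQ₁ hQ) ?_ ?_ (hτQ ▸ h)
  · filter_upwards [hev] with z ⟨hz, hz₁⟩
    simp [e₁.left_inv hz₁, e.right_inv hz]
  · filter_upwards [hev] with z ⟨hz, hz₁⟩
    rintro ⟨p, ⟨hpA, hp⟩, hpz⟩
    have hpe : p = e.symm z := e₁.injOn hp hz₁ hpz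
    subst hpe
    exact ⟨e.symm z, ⟨hpA, e.map_target hz⟩, e.right_inv hz⟩

theorem contMDiff_glEntry (i j : Fin L) :
    ContMDiff 𝓘(ℝ, EuclideanSpace ℝ (Fin L × Fin L)) 𝓘(ℝ, ℝ) ∞
      (fun w : GL (Fin L) ℝ => (w : Matrix (Fin L) (Fin L) ℝ) i j) := by
  have h1 : ContMDiff 𝓘(ℝ, EuclideanSpace ℝ (Fin L × Fin L))
      𝓘(ℝ, EuclideanSpace ℝ (Fin L × Fin L)) ∞ (glCoord L) :=
    contMDiff_isOpenEmbedding (isOpenEmbedding_glCoord L)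
  have h2 : ContDiff ℝ ∞ (fun v : EuclideanSpace ℝ (Fin L × Fin L) => v (i, j)) :=
    (EuclideanSpace.proj (𝕜 := ℝ) (i, j)).contDiff
  exact h2.contMDiff.comp h1

/-- The entries of the matrix valued function that represents `ι ∘ f` in the chart `e`. -/
def chartEntry (ι : G →* GL (Fin L) ℝ) (f : M → G)
    (e : OpenPartialHomeomorph M (EuclideanSpace ℝ (Fin m))) (i j : Fin L) :
    EuclideanSpace ℝ (Fin m) → ℝ :=
  fun y => (ι (f (e.symm y)) : Matrix (Fin L) (Fin L) ℝ) i j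

variable {ι : G →* GL (Fin L) ℝ} {φ : MatForm 𝓘(ℝ, EuclideanSpace ℝ (Fin m)) M L 1}
  {U : Set M} {f : M → G} {e : OpenPartialHomeomorph M (EuclideanSpace ℝ (Fin m))}

theorem contDiffOn_chartEntry
    (hι : ContMDiff 𝓘(ℝ, EuclideanSpace ℝ (Fin n)) 𝓘(ℝ, EuclideanSpace ℝ (Fin L × Fin L)) ∞ ι)
    (hf : ContMDiffOn 𝓘(ℝ, EuclideanSpace ℝ (Fin m)) 𝓘(ℝ, EuclideanSpace ℝ (Fin n)) 1 f U)
    (he : e ∈ IsManifold.maximalAtlas 𝓘(ℝ, EuclideanSpace ℝ (Fin m)) 1 M) (i j : Fin L) :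
    ContDiffOn ℝ 1 (chartEntry ι f e i j) (e.target ∩ e.symm ⁻¹' U) := by
  rw [← contMDiffOn_iff_contDiffOn]
  have h1 := (((contMDiff_glEntry i j).comp hι).of_le (by exact_mod_cast le_top)).comp_contMDiffOn
    (hf.comp ((contMDiffOn_symm_of_mem_maximalAtlas he).mono
      (inter_subset_left : e.target ∩ e.symm ⁻¹' U ⊆ e.target)) fun y hy => hy.2)
  exact h1

/-- The chain rule gives `F⁻¹ dF = ψ` in the chart; multiplying by `F` removes the inverse. -/
theorem fderiv_chartEntry_of_mem_agreementSet
    (hι : ContMDiff 𝓘(ℝ, EuclideanSpace ℝ (Fin n)) 𝓘(ℝ, EuclideanSpace ℝ (Fin L × Fin L)) ∞ ι)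
    (hU : IsOpen U)
    (hf : ContMDiffOn 𝓘(ℝ, EuclideanSpace ℝ (Fin m)) 𝓘(ℝ, EuclideanSpace ℝ (Fin n)) 1 f U)
    (he : e ∈ IsManifold.maximalAtlas 𝓘(ℝ, EuclideanSpace ℝ (Fin m)) 1 M)
    {y : EuclideanSpace ℝ (Fin m)} (hy : y ∈ e.target)
    (hyA : e.symm y ∈ agreementSet n ι φ U f) (i j : Fin L) (v : EuclideanSpace ℝ (Fin m)) :
    fderiv ℝ (chartEntry ι f e i j) y v
      = ∑ q, chartEntry ι f e i q y * toLinearForm ((φ q j).localRep e y) v := by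
  have hd (q j : Fin L) : fderiv ℝ (chartEntry ι f e q j) y v
      = mfderiv 𝓘(ℝ, EuclideanSpace ℝ (Fin L × Fin L)) 𝓘(ℝ, ℝ)
          (fun w : GL (Fin L) ℝ => (w : Matrix (Fin L) (Fin L) ℝ) q j) (ι (f (e.symm y)))
        (mfderiv 𝓘(ℝ, EuclideanSpace ℝ (Fin n)) 𝓘(ℝ, EuclideanSpace ℝ (Fin L × Fin L)) ι
          (f (e.symm y))
        (mfderiv 𝓘(ℝ, EuclideanSpace ℝ (Fin m)) 𝓘(ℝ, EuclideanSpace ℝ (Fin n)) f (e.symm y)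
        (mfderiv 𝓘(ℝ, EuclideanSpace ℝ (Fin m)) 𝓘(ℝ, EuclideanSpace ℝ (Fin m)) e.symm y v))) := by
    have d1 := ((contMDiff_glEntry q j).mdifferentiable (by simp)
      (ι (f (e.symm y)))).hasMFDerivAt
    have d2 := (hι.mdifferentiable (by simp) (f (e.symm y))).hasMFDerivAt
    have d3 := ((hf.contMDiffAt (hU.mem_nhds hyA.1)).mdifferentiableAt one_ne_zero).hasMFDerivAt
    have d4 := ((contMDiffAt_symm_of_mem_maximalAtlas he hy).mdifferentiableAt
      one_ne_zero).hasMFDerivAt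
    have d := (d1.comp (f (e.symm y)) d2).comp y (d3.comp y d4)
    rw [← mfderiv_eq_fderiv]
    have := d.mfderiv
    exact congrArg (fun T : EuclideanSpace ℝ (Fin m) →L[ℝ] ℝ => T v) this
  have hag (i j : Fin L) : ∑ q, ((ι (f (e.symm y)))⁻¹ : GL (Fin L) ℝ).val i q
      * fderiv ℝ (chartEntry ι f e q j) y v = toLinearForm ((φ i j).localRep e y) v := by
    have h1 := congrFun (congrFun hyA.2 i) j
    have h2 := congrArg (fun α : EuclideanSpace ℝ (Fin m) [⋀^Fin 1]→L[ℝ] ℝ => α fun _ =>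
      mfderiv 𝓘(ℝ, EuclideanSpace ℝ (Fin m)) 𝓘(ℝ, EuclideanSpace ℝ (Fin m)) e.symm y v) h1
    -- Evaluating `φ` on the image of `v` under the differential of `e.symm` is the local
    -- representation by definition.
    refine Eq.trans ?_ h2
    simp only [hd]
    exact (sum_smul_ofSubsingleton_apply
      (E := EuclideanSpace ℝ (Fin L × Fin L))
      (fun q => ((ι (f (e.symm y)))⁻¹ : GL (Fin L) ℝ).val i q)
      (fun q => mfderiv 𝓘(ℝ, EuclideanSpace ℝ (Fin L × Fin L)) 𝓘(ℝ, ℝ)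
        (fun w : GL (Fin L) ℝ => (w : Matrix (Fin L) (Fin L) ℝ) q j) (ι (f (e.symm y))))
      fun _ => mfderiv 𝓘(ℝ, EuclideanSpace ℝ (Fin n)) 𝓘(ℝ, EuclideanSpace ℝ (Fin L × Fin L)) ι
          (f (e.symm y))
        (mfderiv 𝓘(ℝ, EuclideanSpace ℝ (Fin m)) 𝓘(ℝ, EuclideanSpace ℝ (Fin n)) f (e.symm y)
        (mfderiv 𝓘(ℝ, EuclideanSpace ℝ (Fin m)) 𝓘(ℝ, EuclideanSpace ℝ (Fin m))
          e.symm y v))).symm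
  set D : Matrix (Fin L) (Fin L) ℝ := fun q j => fderiv ℝ (chartEntry ι f e q j) y v with hD
  set Ψ : Matrix (Fin L) (Fin L) ℝ := fun i j => toLinearForm ((φ i j).localRep e y) v with hΨ
  have hmul : ((ι (f (e.symm y)))⁻¹ : GL (Fin L) ℝ).val * D = Ψ := by
    ext i j
    exact hag i j
  have hmul' : D = (ι (f (e.symm y))).val * Ψ := by
    rw [← hmul, ← mul_assoc, Units.mul_inv, one_mul]
  exact congrFun (congrFun hmul' i) j

theorem structure_equation_of_mem_densityPoints
    [IsManifold 𝓘(ℝ, EuclideanSpace ℝ (Fin m)) 1 M]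
    (hι : ContMDiff 𝓘(ℝ, EuclideanSpace ℝ (Fin n)) 𝓘(ℝ, EuclideanSpace ℝ (Fin L × Fin L)) ∞ ι)
    (hU : IsOpen U)
    (hf : ContMDiffOn 𝓘(ℝ, EuclideanSpace ℝ (Fin m)) 𝓘(ℝ, EuclideanSpace ℝ (Fin n)) 1 f U)
    (he : e ∈ IsManifold.maximalAtlas 𝓘(ℝ, EuclideanSpace ℝ (Fin m)) 1 M)
    (hφ : ∀ i j, ContDiffOn ℝ 1 ((φ i j).localRep e) e.target)
    {Q : M} (hQ : Q ∈ e.source) (hQU : Q ∈ U)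
    (hQA : Q ∈ densityPoints m ((m : ℝ) + 1) (agreementSet n ι φ U f)) (i j : Fin L) :
    extDeriv ((φ i j).localRep e) (e Q)
      + ∑ q, wedgeOne ((φ i q).localRep e (e Q)) ((φ q j).localRep e (e Q)) = 0 := by
  refine structure_equation_at_superdensity_point (μ := volume) (F := chartEntry ι f e)
    (ψ := fun i j => (φ i j).localRep e) (A := e '' (agreementSet n ι φ U f ∩ e.source))
    (V := e.target ∩ e.symm ⁻¹' U) (e.isOpen_inter_preimage_symm hU)
    ⟨e.map_source hQ, by rwa [mem_preimage, e.left_inv hQ]⟩ (contDiffOn_chartEntry hι hf he)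
    (fun i j => (hφ i j).mono inter_subset_left) ?_ ?_ ?_ i j
  · rintro _ - ⟨p, ⟨hpA, hp⟩, rfl⟩ i j v
    exact fderiv_chartEntry_of_mem_agreementSet hι hU hf he (e.map_source hp)
      (by rwa [e.left_inv hp]) i j v
  · rw [finrank_euclideanSpace_fin]
    exact IsDensityPoint.isLittleO_chart hQA he hQ
  · exact (ι (f (e.symm (e Q)))).isUnit

/-- Pulling back by `e.symm` and then by `e` is the identity, since their differentials are inverse
to each other. -/
theorem toLinearForm_localRep_mfderiv (η : Form 𝓘(ℝ, EuclideanSpace ℝ (Fin m)) M 1)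
    (he : e ∈ IsManifold.maximalAtlas 𝓘(ℝ, EuclideanSpace ℝ (Fin m)) 1 M) {P : M}
    (hP : P ∈ e.source) (v : EuclideanSpace ℝ (Fin m)) :
    toLinearForm (η.localRep e (e P))
      (mfderiv 𝓘(ℝ, EuclideanSpace ℝ (Fin m)) 𝓘(ℝ, EuclideanSpace ℝ (Fin m)) e P v)
      = toLinearForm (E := EuclideanSpace ℝ (Fin m)) (η P) v := by
  have hd : e.MDifferentiable 𝓘(ℝ, EuclideanSpace ℝ (Fin m)) 𝓘(ℝ, EuclideanSpace ℝ (Fin m)) :=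
    ⟨(contMDiffOn_of_mem_maximalAtlas he).mdifferentiableOn one_ne_zero,
      (contMDiffOn_symm_of_mem_maximalAtlas he).mdifferentiableOn one_ne_zero⟩
  have h1 : mfderiv 𝓘(ℝ, EuclideanSpace ℝ (Fin m)) 𝓘(ℝ, EuclideanSpace ℝ (Fin m)) e.symm (e P)
      (mfderiv 𝓘(ℝ, EuclideanSpace ℝ (Fin m)) 𝓘(ℝ, EuclideanSpace ℝ (Fin m)) e P v) = v :=
    congrArg (fun T : EuclideanSpace ℝ (Fin m) →L[ℝ] EuclideanSpace ℝ (Fin m) => T v)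
      (hd.symm_comp_deriv hP)
  let η' : M → EuclideanSpace ℝ (Fin m) [⋀^Fin 1]→L[ℝ] ℝ := η
  change η' (e.symm (e P)) (fun _ => mfderiv 𝓘(ℝ, EuclideanSpace ℝ (Fin m))
    𝓘(ℝ, EuclideanSpace ℝ (Fin m)) e.symm (e P)
      (mfderiv 𝓘(ℝ, EuclideanSpace ℝ (Fin m)) 𝓘(ℝ, EuclideanSpace ℝ (Fin m)) e P v))
    = η' P fun _ => v
  rw [e.left_inv hP]
  exact congrArg (fun w => η' P fun _ => w) h1

/-- Both `dφ` and `φ ∧ φ` at `P` are pullbacks of their chart versions along the differential of the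
preferred chart. -/
theorem structure_equation_of_chart
    [IsManifold 𝓘(ℝ, EuclideanSpace ℝ (Fin m)) 1 M] {P : M}
    (h : ∀ i j, extDeriv ((φ i j).localRep (chartAt _ P)) (chartAt _ P P)
      + ∑ q, wedgeOne ((φ i q).localRep (chartAt _ P) (chartAt _ P P))
        ((φ q j).localRep (chartAt _ P) (chartAt _ P P)) = 0) :
    φ.d.at P = -(φ.wedge φ).at P := by
  have he := IsManifold.chart_mem_maximalAtlas (I := 𝓘(ℝ, EuclideanSpace ℝ (Fin m))) (n := 1) P
  have hP := mem_chart_source (EuclideanSpace ℝ (Fin m)) P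
  funext i j
  refine ContinuousAlternatingMap.ext fun (v : Fin 2 → EuclideanSpace ℝ (Fin m)) => ?_
  have h1 := congrArg (fun α : EuclideanSpace ℝ (Fin m) [⋀^Fin 2]→L[ℝ] ℝ => α fun k =>
    mfderiv 𝓘(ℝ, EuclideanSpace ℝ (Fin m)) 𝓘(ℝ, EuclideanSpace ℝ (Fin m))
      (chartAt (EuclideanSpace ℝ (Fin m)) P) P (v k)) (eq_neg_of_add_eq_zero_left (h i j))
  refine Eq.trans h1 ?_
  exact neg_sum_wedgeOne_apply_comp (fun q w => toLinearForm_localRep_mfderiv (φ i q) he hP w)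
    (fun q w => toLinearForm_localRep_mfderiv (φ q j) he hP w) v

/-- A vector pair on which the defect is nonzero at `P` still detects it nearby, by continuity. -/
theorem exists_isOpen_structure_equation_ne
    (hφ : ∀ i j, ContDiffOn ℝ 1 ((φ i j).localRep e) e.target) {P : M} (hP : P ∈ e.source)
    {i j : Fin L}
    (hne : extDeriv ((φ i j).localRep e) (e P)
      + ∑ q, wedgeOne ((φ i q).localRep e (e P)) ((φ q j).localRep e (e P)) ≠ 0) :
    ∃ U : Set M, IsOpen U ∧ P ∈ U ∧ U ⊆ e.source ∧ ∀ Q ∈ U,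
      extDeriv ((φ i j).localRep e) (e Q)
        + ∑ q, wedgeOne ((φ i q).localRep e (e Q)) ((φ q j).localRep e (e Q)) ≠ 0 := by
  have hc := continuousOn_structure_equation (ψ := fun i j => (φ i j).localRep e)
    e.open_target hφ i j
  obtain ⟨v, hv⟩ := DFunLike.ne_iff.1 hne
  exact ⟨e.source ∩ e ⁻¹' (e.target ∩ _),
    e.isOpen_inter_preimage ((hc v).isOpen_inter_preimage e.open_target isOpen_compl_singleton),
    ⟨hP, e.map_source hP, hv⟩, inter_subset_left, fun Q hQ h => hQ.2.2 (DFunLike.congr_fun h v)⟩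

end Manifold

end MCForms

end

/-! ### The two nonexistence statements -/

theorem corollary5p2
    {m n L : ℕ}
    {M : Type*} [TopologicalSpace M] [ChartedSpace (EuclideanSpace ℝ (Fin m)) M]
    [IsManifold 𝓘(ℝ, EuclideanSpace ℝ (Fin m)) 2 M]
    {G : Type*} [TopologicalSpace G] [ChartedSpace (EuclideanSpace ℝ (Fin n)) G] [Group G]
    [LieGroup 𝓘(ℝ, EuclideanSpace ℝ (Fin n)) ∞ G]
    (ι : G →* GL (Fin L) ℝ) (hι : MCForms.IsMatrixLieSubgroup n ι)
    (φ : MCForms.MatForm 𝓘(ℝ, EuclideanSpace ℝ (Fin m)) M L 1) (hφ : φ.IsOfClass 2 1) :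
    (∀ P : M, φ.d.at P ≠ -(φ.wedge φ).at P →
      ∃ U : Set M, IsOpen U ∧ P ∈ U ∧
        ∀ f : M → G,
          ContMDiffOn 𝓘(ℝ, EuclideanSpace ℝ (Fin m)) 𝓘(ℝ, EuclideanSpace ℝ (Fin n)) 1 f U →
          U ∩ MCForms.densityPoints m ((m : ℝ) + 1)
            (MCForms.agreementSet n ι φ U f) = ∅) ∧
    ((∀ Q : M, φ.d.at Q ≠ -(φ.wedge φ).at Q) →
      ∀ U : Set M, IsOpen U →
        ∀ f : M → G,
          ContMDiffOn 𝓘(ℝ, EuclideanSpace ℝ (Fin m)) 𝓘(ℝ, EuclideanSpace ℝ (Fin n)) 1 f U →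
          U ∩ MCForms.densityPoints m ((m : ℝ) + 1)
            (MCForms.agreementSet n ι φ U f) = ∅) := by
  have : IsManifold 𝓘(ℝ, EuclideanSpace ℝ (Fin m)) 1 M :=
    IsManifold.of_le (n := 2) one_le_two
  have hatlas (P : M) := IsManifold.chart_mem_maximalAtlas
    (I := 𝓘(ℝ, EuclideanSpace ℝ (Fin m))) (n := 1) P
  have hφ' (P : M) (i j : Fin L) : ContDiffOn ℝ 1
      ((φ i j).localRep (chartAt (EuclideanSpace ℝ (Fin m)) P)) (chartAt _ P).target :=
    hφ i j _ (IsManifold.chart_mem_maximalAtlas P)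
  refine ⟨fun P hP => ?_, fun hne U hU f hf => ?_⟩
  · have hP' := mt MCForms.structure_equation_of_chart hP
    push Not at hP'
    obtain ⟨i, j, hij⟩ := hP'
    obtain ⟨U, hU, hPU, hUs, hne⟩ := MCForms.exists_isOpen_structure_equation_ne
      (hφ' P) (mem_chart_source _ P) hij
    -- The chart at `P` and the entry `(i, j)` serve for every `Q` in `U`, and `U` was chosen before
    -- `f`.
    exact ⟨U, hU, hPU, fun f hf => eq_empty_of_forall_notMem fun Q hQ => hne Q hQ.1
      (MCForms.structure_equation_of_mem_densityPoints hι.contMDiff hU hf (hatlas P) (hφ' P)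
        (hUs hQ.1) hQ.1 hQ.2 i j)⟩
  -- Here each `Q` is examined in its own preferred chart, so `U` can be any open set.
  · refine eq_empty_of_forall_notMem fun Q hQ => hne Q ?_
    exact MCForms.structure_equation_of_chart
      (MCForms.structure_equation_of_mem_densityPoints hι.contMDiff hU hf (hatlas Q) (hφ' Q)
        (mem_chart_source _ Q) hQ.1 hQ.2)
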